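/- Conventions. Let $I$ be a finite set. A chamber system over $I$ is a set $\Delta$ of chambers together with an equivalence relation on $\Delta$ for each $i\in I$, whose classes are called $i$-panels; two distinct chambers in a common $i$-panel are called $i$-adjacent, and a gallery of type $(i_1,\dots,i_k)$ is a sequence $c_0,\dots,c_k$ with $c_{m-1}$ and $c_m$ being $i_m$-adjacent for each $m$. Write $\operatorname{dist}_\Delta$ for the length of a shortest gallery. A building of type $M=(m_{ij})_{i,j\in I}$, where $M$ is a Coxeter matrix with Coxeter group $W$, is a non-empty chamber system over $I$ in which every panel has at least two chambers, and which admits a map $\delta\colon\Delta\times\Delta\to W$ such that for every reduced word $f$ in the generators and all chambers $c,d$, $\delta(c,d)$ is the element represented by $f$ if and only if there is a gallery of type $f$ from $c$ to $d$. It is right-angled if $m_{ij}\in\{2,\infty\}$ for all $i\neq j$, and semiregular with parameters $(q_i)_{i\in I}$ if for each $i$ all $i$-panels have the same (possibly infinite) cardinality $q_i\ge 2$. Given sets $X_i$ with $|X_i|=q_i$, a legal colouring is a map $\lambda=(\lambda_i)_{i\in I}\colon\Delta\to\prod_{i\in I}X_i$ such that for each $i$-panel $\mathcal P$, $\lambda_i|_{\mathcal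 P}\colon\mathcal P\to X_i$ is a bijection and $\lambda_j|_{\mathcal P}$ is constant for every $j\ne i$. Proposition (implosion). Let $\Delta$ be a semiregular right-angled building of type $M$ over the finite set $I$, and let $\lambda$ be a legal colouring of $\Delta$ using colour sets $X_i$ ($i\in I$). For every $i\in I$ let $\equiv_i$ be an equivalence relation on $X_i$, write $[x]_i$ for the class of $x\in X_i$, and let $I'=\{i\in I\mid {\equiv_i}\text{ is not the universal relation}\}$. Let $M'=(m_{ij})_{i,j\in I'}$ be the type induced on $I'$. Then there exists a semiregular right-angled building of type $M'$ with parameters $q'_i=|X_i/{\equiv_i}|$ ($i\in I'$), together with a legal colouring using the colour sets $X_i/{\equiv_i}$ ($i\in I'$). Moreover, for every such building $\Delta'$ and every such legal colouring $\lambda'$ of $\Delta'$, there exists a surjective map $\tau\colon\Delta\to\Delta'$ such that $\lambda'_i(\tau(c))=[\lambda_i(c)]_i$ for all chambers $c\in\Delta$ and all $i\in I'$, and such that $\operatorname{dist}_{\Delta'}(\tau(c_1),\tau(c_2))\le\operatorname{dist}_\Delta(c_1,c_2)$ for all $c_1,c_2\in\Delta$. -/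

import Mathlib

universe u v w v'

/-- A chamber system over `I`: every `i : I` determines an equivalence relation on the set `C` of
chambers, whose classes are the `i`-panels. -/
structure ChamberSystem (I : Type*) (C : Type*) where
  /-- Being in the same `i`-panel. -/
  rel : I → Setoid C

namespace ChamberSystem

variable {I C : Type*}

/-- The `i`-panel containing the chamber `c`. -/
def panel (S : ChamberSystem I C) (i : I) (c : C) : Set C :=
  {d | (S.rel i) c d}

/-- `i`-adjacency: distinct chambers in a common `i`-panel. -/
def Adj (S : ChamberSystem I C) (i : I) (c d : C) : Prop :=
  (S.rel i) c d ∧ c ≠ d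

/-- `S.Joined f c d`: there is a gallery of type `f` from `c` to `d`. -/
inductive Joined (S : ChamberSystem I C) : List I → C → C → Prop
  | nil (c : C) : Joined S [] c c
  | cons {i : I} {f : List I} {c d e : C} :
      S.Adj i c d → Joined S f d e → Joined S (i :: f) c e

/-- The graph on the chambers whose edges are the pairs of adjacent chambers (of any type). -/
def graph (S : ChamberSystem I C) : SimpleGraph C where
  Adj c d := ∃ i, S.Adj i c d
  symm := ⟨fun _ _ ⟨i, h, hne⟩ => ⟨i, (S.rel i).symm h, hne.symm⟩⟩
  loopless := ⟨fun _ ⟨_, _, hne⟩ => hne rfl⟩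

/-- Gallery distance: the length of a shortest gallery. (Galleries between any two chambers exist
in a building.) -/
noncomputable def dist (S : ChamberSystem I C) (c d : C) : ℕ :=
  S.graph.dist c d

/-- A building of type `M`: a nonempty chamber system all of whose panels have at least two
chambers, and which has a Weyl distance function `δ` with values in the Coxeter group of `M`, i.e.
for every reduced word `f`, `δ c d` is the element represented by `f` if and only if `c` and `d`
are joined by a gallery of type `f`. -/
structure IsBuilding (S : ChamberSystem I C) (M : CoxeterMatrix I) : Prop where
  nonempty : Nonempty C
  exists_adj : ∀ (i : I) (c : C), ∃ d, S.Adj i c d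
  exists_weylDist : ∃ δ : C → C → M.Group,
    ∀ f : List I, M.toCoxeterSystem.IsReduced f →
      ∀ c d : C, δ c d = M.toCoxeterSystem.wordProd f ↔ S.Joined f c d

/-- All `i`-panels have the same, possibly infinite, cardinality `q i ≥ 2`. -/
def IsSemiregular {I : Type u} {C : Type v} (S : ChamberSystem I C)
    (q : I → Cardinal.{w}) : Prop :=
  ∀ i, 2 ≤ q i ∧
    ∀ c, Cardinal.lift.{w} (Cardinal.mk (S.panel i c)) = Cardinal.lift.{v} (q i)

/-- A legal colouring with colour sets `X i`: on every `i`-panel, the `i`-colour is a bijection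
onto `X i` and the other colours are constant. -/
structure IsLegalColouring (S : ChamberSystem I C) {X : I → Type*} (lam : C → ∀ i, X i) :
    Prop where
  bijOn : ∀ (i : I) (c : C), Set.BijOn (fun d => lam d i) (S.panel i c) Set.univ
  const : ∀ (i : I) (c : C), ∀ j, j ≠ i → ∀ d ∈ S.panel i c, lam d j = lam c j

end ChamberSystem

namespace CoxeterMatrix

variable {I : Type*}

/-- All off-diagonal entries are `2` or `∞` (the latter is encoded by `0`). -/
def IsRightAngled (M : CoxeterMatrix I) : Prop :=
  ∀ i j, i ≠ j → M i j = 2 ∨ M i j = 0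

/-- The Coxeter matrix (diagram) induced on the subset `{i | p i}` of the index set. -/
def induce (M : CoxeterMatrix I) (p : I → Prop) : CoxeterMatrix {i // p i} where
  M := M.M.submatrix Subtype.val Subtype.val
  isSymm := M.isSymm.submatrix _
  diagonal i := M.diagonal i.1
  off_diagonal i j h := M.off_diagonal i.1 j.1 fun e => h (Subtype.ext e)

end CoxeterMatrix

/-- A semiregular right-angled building of type `M` with parameters `q`. -/
structure ChamberSystem.IsSemiregularRAB {I : Type u} {C : Type v}
    (S : ChamberSystem I C) (M : CoxeterMatrix I) (q : I → Cardinal.{w}) : Prop where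
  rightAngled : M.IsRightAngled
  building : S.IsBuilding M
  semiregular : S.IsSemiregular q

/-! Both halves follow from one extension principle, `IsLegalColouring.exists_map`. Let `Y` be a set
with maps that behave like the projections onto the chamber of a given colour in a panel
(`PanelMoves`). Transporting a base point along galleries then gives a well-defined map from the
building to `Y`. Independence of the gallery is a monodromy argument. Any gallery shortens to one of
reduced type without changing the transported point (`Track.exists_isReduced`). Reduced words for
the same element differ by commutations (`IsRightAngled.comm_of_wordProd_eq`), and each commutation
is a square of chambers around which the moves commute.

For existence, take `Y` to be the building itself and move to a chosen representative of each colour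
class. The result is a retraction φ that collapses the panels of universal type. Its fixed chambers
form the new building, whose Weyl distance is the old one followed by the retraction of the Coxeter
group onto a parabolic subgroup.

For the map τ, take `Y = Δ'` with its own projections, precomposed with the class map. Adjacent
chambers go to equal or adjacent ones, so distances do not grow. -/

namespace CoxeterMatrix

/-! ### The word problem in right-angled Coxeter groups. -/

variable {I : Type*} (M : CoxeterMatrix I)

/-- Two words are commutation equivalent if they differ by swaps of adjacent letters `i`, `j`
with `M i j = 2`. -/
inductive Comm : List I → List I → Prop
  | nil : Comm [] []
  | cons (i : I) {f g : List I} : Comm f g → Comm (i :: f) (i :: g)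
  | swap {i j : I} (f : List I) : M i j = 2 → Comm (i :: j :: f) (j :: i :: f)
  | trans {f g h : List I} : Comm f g → Comm g h → Comm f h

/-- The letter `i` can be moved to the front of a word by commutations. -/
def Front (i : I) : List I → Prop
  | [] => False
  | k :: f => k = i ∨ (M i k = 2 ∧ Front i f)

/-- No two equal letters of the word can be brought together by commutations. -/
def CommReduced : List I → Prop
  | [] => True
  | i :: f => CommReduced f ∧ ¬ M.Front i f

variable {M}

theorem ne_of_eq_two {i j : I} (h : M i j = 2) : i ≠ j := by
  rintro rfl
  simp at h

theorem eq_two_symm {i j : I} (h : M i j = 2) : M j i = 2 := by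
  rw [M.symmetric, h]

namespace Comm

theorem refl : ∀ f : List I, M.Comm f f
  | [] => nil
  | i :: f => (refl f).cons i

theorem symm {f g : List I} (h : M.Comm f g) : M.Comm g f := by
  induction h with
  | nil => exact nil
  | cons i _ ih => exact ih.cons i
  | swap f h => exact swap f (eq_two_symm h)
  | trans _ _ h₁ h₂ => exact h₂.trans h₁

theorem length_eq {f g : List I} (h : M.Comm f g) : f.length = g.length := by
  induction h with
  | nil => rfl
  | cons i _ ih => simp [ih]
  | swap f h => simp
  | trans _ _ h₁ h₂ => exact h₁.trans h₂

variable [DecidableEq I]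

/-- The two claims are proved together because the second is transitive only with the help of the
first. They make `mulWord` well defined on commutation classes. -/
theorem front_and_erase {f g : List I} (h : M.Comm f g) (i : I) :
    (M.Front i f ↔ M.Front i g) ∧ (M.Front i f → M.Comm (f.erase i) (g.erase i)) := by
  induction h with
  | nil => exact ⟨Iff.rfl, fun _ => nil⟩
  | @cons k f g h ih =>
    refine ⟨by simp only [Front, ih.1], ?_⟩
    by_cases hk : k = i
    · subst hk
      simpa using fun _ => h
    · rintro (h' | ⟨-, h'⟩)
      · exact absurd h' hk
      · rw [List.erase_cons_tail (by simpa using hk), List.erase_cons_tail (by simpa using hk)]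
        exact (ih.2 h').cons k
  | @swap j k f h =>
    have hjk := ne_of_eq_two h
    constructor
    · have h' := eq_two_symm h
      simp only [Front]
      constructor
      · rintro (rfl | ⟨h₁, rfl | ⟨h₂, h₃⟩⟩) <;> simp_all
      · rintro (rfl | ⟨h₁, rfl | ⟨h₂, h₃⟩⟩) <;> simp_all
    · intro _
      by_cases hj : j = i
      · subst hj
        rw [List.erase_cons_head, List.erase_cons_tail (by simpa using hjk.symm),
          List.erase_cons_head]
        exact refl _
      · by_cases hk : k = i
        · subst hk
          rw [List.erase_cons_head, List.erase_cons_tail (by simpa using hjk),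
            List.erase_cons_head]
          exact refl _
        · rw [List.erase_cons_tail (by simpa using hj), List.erase_cons_tail (by simpa using hk),
            List.erase_cons_tail (by simpa using hk), List.erase_cons_tail (by simpa using hj)]
          exact swap _ h
  | trans _ _ h₁ h₂ => exact ⟨h₁.1.trans h₂.1, fun h => (h₁.2 h).trans (h₂.2 (h₁.1.1 h))⟩

end Comm

section Erase

variable [DecidableEq I]

theorem Front.comm_cons_erase {i : I} : ∀ {f : List I}, M.Front i f →
    M.Comm (i :: f.erase i) f
  | k :: f, h => by
    by_cases hk : k = i
    · subst hk
      simpa using Comm.refl _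
    · obtain h | ⟨h, h'⟩ := h
      · exact absurd h hk
      · rw [List.erase_cons_tail (by simpa using hk)]
        exact (Comm.swap _ h).trans (h'.comm_cons_erase.cons k)

theorem Front.of_erase {i j : I} (hij : M i j = 2) : ∀ {f : List I}, M.Front i (f.erase j) →
    M.Front i f
  | [], h => h
  | k :: f, h => by
    by_cases hk : k = j
    · subst hk
      exact Or.inr ⟨hij, by simpa using h⟩
    · rw [List.erase_cons_tail (by simpa using hk)] at h
      exact h.imp id fun h => ⟨h.1, h.2.of_erase hij⟩

theorem Front.erase {i j : I} (hij : i ≠ j) : ∀ {f : List I}, M.Front i f →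
    M.Front i (f.erase j)
  | k :: f, h => by
    by_cases hk : k = j
    · subst hk
      obtain h | h := h
      · exact absurd h.symm hij
      · simpa using h.2
    · rw [List.erase_cons_tail (by simpa using hk)]
      exact h.imp id fun h => ⟨h.1, h.2.erase hij⟩

theorem CommReduced.erase {i : I} : ∀ {f : List I}, M.CommReduced f → M.Front i f →
    M.CommReduced (f.erase i) ∧ ¬ M.Front i (f.erase i)
  | k :: f, hf, h => by
    by_cases hk : k = i
    · subst hk
      rw [List.erase_cons_head]
      exact hf
    · obtain h | ⟨h, h'⟩ := h
      · exact absurd h hk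
      · rw [List.erase_cons_tail (by simpa using hk)]
        have ih := hf.1.erase h'
        exact ⟨⟨ih.1, fun h'' => hf.2 (h''.of_erase (eq_two_symm h))⟩,
          fun h'' => h''.elim hk fun h'' => ih.2 h''.2⟩

open Classical in
/-- Left multiplication by a generator on words. -/
noncomputable def mulWord (M : CoxeterMatrix I) (i : I) (f : List I) : List I :=
  if M.Front i f then f.erase i else i :: f

theorem CommReduced.mulWord {f : List I} (hf : M.CommReduced f) (i : I) :
    M.CommReduced (M.mulWord i f) := by
  unfold CoxeterMatrix.mulWord
  split_ifs with h
  · exact (hf.erase h).1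
  · exact ⟨hf, h⟩

theorem Comm.mulWord {f g : List I} (h : M.Comm f g) (i : I) :
    M.Comm (M.mulWord i f) (M.mulWord i g) := by
  have := h.front_and_erase i
  unfold CoxeterMatrix.mulWord
  by_cases hf : M.Front i f
  · rw [if_pos hf, if_pos (this.1.1 hf)]
    exact this.2 hf
  · rw [if_neg hf, if_neg (mt this.1.2 hf)]
    exact h.cons i

theorem comm_mulWord_mulWord {f : List I} (hf : M.CommReduced f) (i : I) :
    M.Comm (M.mulWord i (M.mulWord i f)) f := by
  unfold CoxeterMatrix.mulWord
  by_cases h : M.Front i f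
  · rw [if_pos h, if_neg (hf.erase h).2]
    exact h.comm_cons_erase
  · have h' : M.Front i (i :: f) := Or.inl rfl
    rw [if_neg h, if_pos h', List.erase_cons_head]
    exact Comm.refl f

/-- Inserting or deleting a letter that commutes with `i` does not affect whether `i` can reach the
front. -/
theorem mulWord_comm {i j : I} (hij : M i j = 2) (f : List I) :
    M.Comm (M.mulWord i (M.mulWord j f)) (M.mulWord j (M.mulWord i f)) := by
  have hji := eq_two_symm hij
  have hne := ne_of_eq_two hij
  have e₁ : M.Front i (f.erase j) ↔ M.Front i f := ⟨fun h => h.of_erase hij, fun h => h.erase hne⟩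
  have e₂ : M.Front j (f.erase i) ↔ M.Front j f :=
    ⟨fun h => h.of_erase hji, fun h => h.erase hne.symm⟩
  have e₃ : M.Front i (j :: f) ↔ M.Front i f :=
    ⟨fun h => h.elim (fun h => absurd h.symm hne) And.right, fun h => Or.inr ⟨hij, h⟩⟩
  have e₄ : M.Front j (i :: f) ↔ M.Front j f :=
    ⟨fun h => h.elim (fun h => absurd h hne) And.right, fun h => Or.inr ⟨hji, h⟩⟩
  have e₅ : (i :: f).erase j = i :: f.erase j := List.erase_cons_tail (by simpa using hne)
  have e₆ : (j :: f).erase i = j :: f.erase i := List.erase_cons_tail (by simpa using hne.symm)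
  unfold CoxeterMatrix.mulWord
  by_cases h₁ : M.Front i f <;> by_cases h₂ : M.Front j f <;>
    simp only [h₁, h₂, e₁, e₂, e₃, e₄, e₅, e₆, if_true, if_false]
  · rw [List.erase_comm]
    exact Comm.refl _
  · exact Comm.refl _
  · exact Comm.refl _
  · exact Comm.swap f hij

variable (M) in
/-- Commutation-reduced words up to commutation. -/
def commSetoid : Setoid {f : List I // M.CommReduced f} where
  r f g := M.Comm f.1 g.1
  iseqv := ⟨fun f => Comm.refl f.1, Comm.symm, Comm.trans⟩

variable (M) in
/-- The permutation of the classes of commutation-reduced words induced by a generator. -/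
noncomputable def wordPerm (i : I) : Equiv.Perm (Quotient M.commSetoid) :=
  Function.Involutive.toPerm
    (Quotient.map (fun f => ⟨M.mulWord i f.1, f.2.mulWord i⟩) fun _ _ h => Comm.mulWord h i) <| by
      rintro ⟨f⟩
      exact Quotient.sound (comm_mulWord_mulWord f.2 i)

theorem wordPerm_mk (i : I) (f : {f : List I // M.CommReduced f}) :
    M.wordPerm i (Quotient.mk _ f) = Quotient.mk _ ⟨M.mulWord i f.1, f.2.mulWord i⟩ := rfl

theorem wordPerm_mul_self (i : I) : M.wordPerm i * M.wordPerm i = 1 := by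
  ext ⟨f⟩
  exact Quotient.sound (comm_mulWord_mulWord f.2 i)

end Erase

/-- The entry `0` encodes ∞ and gives the vacuous relation with exponent `0`, so only involutions
and commutations remain. -/
theorem IsRightAngled.isLiftable (hM : M.IsRightAngled) {G : Type*} [Monoid G] {φ : I → G}
    (h₁ : ∀ i, φ i * φ i = 1) (h₂ : ∀ i j, M i j = 2 → φ i * φ j = φ j * φ i) :
    M.IsLiftable φ := by
  intro i j
  by_cases hij : i = j
  · subst hij
    rw [h₁, one_pow]
  · obtain h | h := hM i j hij
    · rw [h, pow_two]
      nth_rw 2 [h₂ i j h]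
      rw [mul_assoc, ← mul_assoc (φ j), h₁, one_mul, h₁]
    · rw [h, pow_zero]

theorem IsRightAngled.wordPerm_isLiftable [DecidableEq I] (hM : M.IsRightAngled) :
    M.IsLiftable M.wordPerm := by
  refine hM.isLiftable wordPerm_mul_self fun i j h => ?_
  ext ⟨f⟩
  exact Quotient.sound (mulWord_comm h f.1)

theorem simple_comm {i j : I} (h : M i j = 2) :
    M.toCoxeterSystem.simple i * M.toCoxeterSystem.simple j =
      M.toCoxeterSystem.simple j * M.toCoxeterSystem.simple i := by
  have := M.toCoxeterSystem.simple_mul_simple_pow i j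
  rw [h, pow_two] at this
  rw [eq_inv_of_mul_eq_one_left this, mul_inv_rev, CoxeterSystem.inv_simple,
    CoxeterSystem.inv_simple]

theorem Comm.wordProd_eq {f g : List I} (h : M.Comm f g) :
    M.toCoxeterSystem.wordProd f = M.toCoxeterSystem.wordProd g := by
  induction h with
  | nil => rfl
  | cons i _ ih => rw [CoxeterSystem.wordProd_cons, CoxeterSystem.wordProd_cons, ih]
  | swap f h =>
    simp only [CoxeterSystem.wordProd_cons, ← mul_assoc, simple_comm h]
  | trans _ _ h₁ h₂ => exact h₁.trans h₂

theorem _root_.CoxeterSystem.IsReduced.of_cons {W : Type*} [Group W] {cs : CoxeterSystem M W}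
    {i : I} {f : List I} (h : cs.IsReduced (i :: f)) : cs.IsReduced f := by
  simpa using h.drop 1

/-- Two equal letters brought together would cancel and leave a word shorter by two. -/
theorem commReduced_of_isReduced : ∀ {f : List I}, M.toCoxeterSystem.IsReduced f →
    M.CommReduced f
  | [], _ => trivial
  | i :: f, h => by
    classical
    refine ⟨commReduced_of_isReduced h.of_cons, fun hi => ?_⟩
    have h₁ := hi.comm_cons_erase
    have h₂ := h.eq
    rw [((h₁.symm).cons i).wordProd_eq, CoxeterSystem.wordProd_cons, CoxeterSystem.wordProd_cons,
      CoxeterSystem.simple_mul_simple_cancel_left] at h₂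
    have h₃ := M.toCoxeterSystem.length_wordProd_le (f.erase i)
    have h₄ := h₁.length_eq
    simp only [List.length_cons] at h₂ h₄
    omega

/-- Acting on the empty word, every letter of a commutation-reduced word is prepended and none
cancels. Hence the group element determines the commutation class. -/
theorem CommReduced.lift_wordProd [DecidableEq I] (hM : M.IsRightAngled) :
    ∀ {f : List I} (hf : M.CommReduced f),
      M.toCoxeterSystem.lift ⟨M.wordPerm, hM.wordPerm_isLiftable⟩ (M.toCoxeterSystem.wordProd f)
        (Quotient.mk _ ⟨[], trivial⟩) = Quotient.mk _ ⟨f, hf⟩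
  | [], hf => by simp
  | i :: f, hf => by
    rw [CoxeterSystem.wordProd_cons, map_mul, Equiv.Perm.mul_apply, hf.1.lift_wordProd hM,
      CoxeterSystem.lift_apply_simple, wordPerm_mk]
    congr 2
    exact if_neg hf.2

/-- In a right-angled Coxeter group, reduced words for the same element are related by
commutations. -/
theorem IsRightAngled.comm_of_wordProd_eq (hM : M.IsRightAngled) {f g : List I}
    (hf : M.toCoxeterSystem.IsReduced f) (hg : M.toCoxeterSystem.IsReduced g)
    (h : M.toCoxeterSystem.wordProd f = M.toCoxeterSystem.wordProd g) : M.Comm f g := by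
  classical
  have h₁ := (commReduced_of_isReduced hf).lift_wordProd hM
  rw [h, (commReduced_of_isReduced hg).lift_wordProd hM] at h₁
  exact Comm.symm (Quotient.exact h₁)

theorem IsRightAngled.isReduced_pair (hM : M.IsRightAngled) {i j : I} (hij : i ≠ j) :
    M.toCoxeterSystem.IsReduced [i, j] := by
  classical
  have h₁ (k : I) : M.toCoxeterSystem.IsReduced [k] := by
    rw [CoxeterSystem.IsReduced, CoxeterSystem.wordProd_singleton, CoxeterSystem.length_simple,
      List.length_singleton]
  have h₂ := M.toCoxeterSystem.length_simple_mul (M.toCoxeterSystem.simple j) i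
  rw [CoxeterSystem.length_simple] at h₂
  obtain h | h := h₂
  · rw [CoxeterSystem.IsReduced, CoxeterSystem.wordProd_cons, CoxeterSystem.wordProd_singleton, h]
    rfl
  · have h₃ := eq_inv_of_mul_eq_one_left
      (M.toCoxeterSystem.length_eq_zero_iff.1 (Nat.succ.inj h))
    rw [CoxeterSystem.inv_simple] at h₃
    have h₄ := hM.comm_of_wordProd_eq (h₁ i) (h₁ j) (by
      rw [CoxeterSystem.wordProd_singleton, CoxeterSystem.wordProd_singleton, h₃])
    have h₅ : j = i ∨ _ := (h₄.front_and_erase i).1.1 (Or.inl rfl)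
    exact absurd (h₅.resolve_right fun h => h.2).symm hij

end CoxeterMatrix

/-! ### Galleries and Weyl distance. -/

namespace ChamberSystem

variable {I C : Type*} {S : ChamberSystem I C} {M : CoxeterMatrix I}

theorem Adj.symm {i : I} {c d : C} (h : S.Adj i c d) : S.Adj i d c :=
  ⟨(S.rel i).symm h.1, h.2.symm⟩

theorem Adj.trans {i : I} {c d e : C} (h : S.Adj i c d) (h' : S.Adj i d e) (hne : c ≠ e) :
    S.Adj i c e :=
  ⟨(S.rel i).trans h.1 h'.1, hne⟩

theorem Joined.reachable {f : List I} {c d : C} (h : S.Joined f c d) : S.graph.Reachable c d := by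
  induction h with
  | nil c => exact SimpleGraph.Reachable.refl c
  | cons h _ ih => exact (SimpleGraph.Adj.reachable (show S.graph.Adj _ _ from ⟨_, h⟩)).trans ih

/-- `δ` is a Weyl distance function on `S`. -/
def IsWeylDist (S : ChamberSystem I C) (M : CoxeterMatrix I) (δ : C → C → M.Group) : Prop :=
  ∀ f : List I, M.toCoxeterSystem.IsReduced f →
    ∀ c d : C, δ c d = M.toCoxeterSystem.wordProd f ↔ S.Joined f c d

namespace IsWeylDist

variable {δ : C → C → M.Group} (hδ : S.IsWeylDist M δ)
include hδ

theorem exists_joined (c d : C) : ∃ f : List I, M.toCoxeterSystem.IsReduced f ∧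
    δ c d = M.toCoxeterSystem.wordProd f ∧ S.Joined f c d := by
  obtain ⟨f, hf, h⟩ := M.toCoxeterSystem.exists_isReduced (δ c d)
  exact ⟨f, hf, h, (hδ f hf c d).1 h⟩

theorem eq_one_iff {c d : C} : δ c d = 1 ↔ c = d := by
  have h := hδ [] (by simp [CoxeterSystem.IsReduced]) c d
  rw [CoxeterSystem.wordProd_nil] at h
  rw [h]
  constructor
  · rintro ⟨⟩
    rfl
  · rintro rfl
    exact Joined.nil c

/-- If multiplying by the generator lengthens `δ c e`, prepend a step to a reduced gallery.
Otherwise some reduced gallery from `c` starts inside the `i`-panel of `d`; its first step either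
lands on `d` or can be restarted from `d`. -/
theorem adj_left {i : I} {c d : C} (h : S.Adj i d c) (e : C) :
    δ d e = M.toCoxeterSystem.simple i * δ c e ∨ δ d e = δ c e := by
  obtain hl | hl := M.toCoxeterSystem.length_simple_mul (δ c e) i
  · obtain ⟨f, hf, hw, hj⟩ := hδ.exists_joined c e
    have hif : M.toCoxeterSystem.IsReduced (i :: f) := by
      rw [CoxeterSystem.IsReduced, CoxeterSystem.wordProd_cons, ← hw, hl, hw, hf.eq,
        List.length_cons]
    left
    rw [hw, ← CoxeterSystem.wordProd_cons]
    exact (hδ _ hif d e).2 (Joined.cons h hj)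
  · obtain ⟨f, hf, hw⟩ := M.toCoxeterSystem.exists_isReduced
      (M.toCoxeterSystem.simple i * δ c e)
    have hif' : M.toCoxeterSystem.wordProd (i :: f) = δ c e := by
      rw [CoxeterSystem.wordProd_cons, ← hw, CoxeterSystem.simple_mul_simple_cancel_left]
    have hif : M.toCoxeterSystem.IsReduced (i :: f) := by
      rw [CoxeterSystem.IsReduced, hif', ← hl, hw, hf.eq, List.length_cons]
    obtain _ | ⟨hb, hj⟩ := (hδ _ hif c e).1 hif'.symm
    rename_i b
    by_cases hbd : b = d
    · subst hbd
      exact Or.inl (((hδ f hf b e).2 hj).trans hw.symm)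
    · right
      rw [← hif']
      exact (hδ _ hif d e).2 (Joined.cons (h.trans hb (Ne.symm hbd)) hj)

theorem length_le {f : List I} {c d : C} (h : S.Joined f c d) :
    M.toCoxeterSystem.length (δ c d) ≤ f.length := by
  induction h with
  | nil c => simp [hδ.eq_one_iff.2 rfl]
  | @cons i f c d e h _ ih =>
    rw [List.length_cons]
    obtain h' | h' := hδ.adj_left h e
    · have := M.toCoxeterSystem.length_simple_mul (δ d e) i
      rw [h']
      omega
    · rw [h']
      omega

/-- Distinct `b`, `b'` would be `i`-adjacent, so `b` would reach `e` by reduced galleries of types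
`f` and `i :: f`, which have different lengths. -/
theorem eq_of_joined {i : I} {f : List I} (hf : M.toCoxeterSystem.IsReduced (i :: f))
    {b b' d e : C} (hb : S.Adj i d b) (hb' : S.Adj i d b') (h : S.Joined f b e)
    (h' : S.Joined f b' e) : b = b' := by
  by_contra hne
  have h₁ := (hδ _ hf b e).2 (Joined.cons (hb.symm.trans hb' hne) h')
  have h₂ := (hδ f hf.of_cons b e).2 h
  have h₃ := hf.eq
  rw [← h₁, h₂, hf.of_cons.eq, List.length_cons] at h₃
  omega

theorem exists_adj_adj (hM : M.IsRightAngled) {i j : I} (hij : M i j = 2) {c d e : C}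
    (h : S.Adj i c d) (h' : S.Adj j d e) : ∃ b, S.Adj j c b ∧ S.Adj i b e := by
  have hne := CoxeterMatrix.ne_of_eq_two hij
  have h₁ := (hδ _ (hM.isReduced_pair hne) c e).2 (Joined.cons h (Joined.cons h' (Joined.nil e)))
  rw [(CoxeterMatrix.Comm.swap [] hij).wordProd_eq] at h₁
  obtain _ | ⟨h₂, _ | ⟨h₃, _ | _⟩⟩ := (hδ _ (hM.isReduced_pair hne.symm) c e).1 h₁
  exact ⟨_, h₂, h₃⟩

theorem induction_on {P : C → Prop} {c₀ : C} (base : P c₀)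
    (step : ∀ i c d, S.Adj i c d → P c → P d) (c : C) : P c := by
  obtain ⟨f, -, -, hf⟩ := hδ.exists_joined c c₀
  induction hf with
  | nil c => exact base
  | cons h _ ih => exact step _ _ _ h.symm (ih base)

theorem connected [Nonempty C] : S.graph.Connected :=
  { preconnected := fun c d => (hδ.exists_joined c d).choose_spec.2.2.reachable }

end IsWeylDist

/-! ### Projections defined by a legal colouring. -/

namespace IsLegalColouring

variable {X : I → Type*} {lam : C → ∀ i, X i} (hlam : S.IsLegalColouring lam)
include hlam

theorem eq_of_rel {i : I} {c d : C} (h : S.rel i c d) (h' : lam c i = lam d i) : c = d :=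
  (hlam.bijOn i c).injOn ((S.rel i).refl c) h h'

theorem colour_eq {i j : I} (hji : j ≠ i) {c d : C} (h : S.rel i c d) : lam d j = lam c j :=
  hlam.const i c j hji d h

/-- The chamber of colour `x` in the `i`-panel of `c`. -/
noncomputable def proj (i : I) (x : X i) (c : C) : C :=
  ((hlam.bijOn i c).surjOn (Set.mem_univ x)).choose

theorem rel_proj (i : I) (x : X i) (c : C) : S.rel i c (hlam.proj i x c) :=
  ((hlam.bijOn i c).surjOn (Set.mem_univ x)).choose_spec.1

theorem proj_colour (i : I) (x : X i) (c : C) : lam (hlam.proj i x c) i = x :=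
  ((hlam.bijOn i c).surjOn (Set.mem_univ x)).choose_spec.2

theorem proj_colour_of_ne {i j : I} (hji : j ≠ i) (x : X i) (c : C) :
    lam (hlam.proj i x c) j = lam c j :=
  hlam.colour_eq hji (hlam.rel_proj i x c)

theorem proj_eq_of_rel {i : I} {c d : C} (h : S.rel i c d) : hlam.proj i (lam d i) c = d :=
  hlam.eq_of_rel ((S.rel i).trans ((S.rel i).symm (hlam.rel_proj i _ c)) h)
    (hlam.proj_colour i _ c)

theorem proj_eq_self_iff {i : I} {x : X i} {c : C} : hlam.proj i x c = c ↔ lam c i = x := by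
  constructor
  · intro h
    rw [← h, hlam.proj_colour]
  · rintro rfl
    exact hlam.proj_eq_of_rel ((S.rel i).refl c)

theorem proj_proj (i : I) (x y : X i) (c : C) :
    hlam.proj i x (hlam.proj i y c) = hlam.proj i x c := by
  have h := hlam.proj_eq_of_rel ((S.rel i).trans ((S.rel i).symm (hlam.rel_proj i y c))
    (hlam.rel_proj i x c))
  rwa [hlam.proj_colour] at h

/-- When neither projection is trivial on `c`, the path through both panels completes to a square,
and the colours identify its fourth vertex. -/
theorem proj_comm {δ : C → C → M.Group} (hδ : S.IsWeylDist M δ) (hM : M.IsRightAngled)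
    {i j : I} (hij : M i j = 2) (x : X i) (y : X j) (c : C) :
    hlam.proj i x (hlam.proj j y c) = hlam.proj j y (hlam.proj i x c) := by
  have hne := CoxeterMatrix.ne_of_eq_two hij
  by_cases h₁ : lam c j = y
  · have h₂ := hlam.proj_colour_of_ne hne.symm x c
    rw [hlam.proj_eq_self_iff.2 h₁, hlam.proj_eq_self_iff.2 (h₂.trans h₁)]
  by_cases h₃ : lam c i = x
  · have h₂ := hlam.proj_colour_of_ne hne y c
    rw [hlam.proj_eq_self_iff.2 h₃, hlam.proj_eq_self_iff.2 (h₂.trans h₃)]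
  obtain ⟨b, hb, hb'⟩ := hδ.exists_adj_adj hM (CoxeterMatrix.eq_two_symm hij)
    (c := c) (d := hlam.proj j y c) (e := hlam.proj i x (hlam.proj j y c))
    ⟨hlam.rel_proj j y c, fun h => h₁ (hlam.proj_eq_self_iff.1 h.symm)⟩
    ⟨hlam.rel_proj i x _, fun h => h₃ <| by
      rw [← hlam.proj_colour_of_ne hne y c, hlam.proj_eq_self_iff.1 h.symm]⟩
  have h₄ := hlam.proj_eq_of_rel hb.1
  have h₅ := hlam.proj_eq_of_rel hb'.1
  rw [← hlam.colour_eq hne hb'.1, hlam.proj_colour] at h₄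
  rw [hlam.proj_colour_of_ne hne.symm, hlam.proj_colour] at h₅
  rw [h₄, h₅]

theorem exists_colour_eq [Finite I] [Nonempty C] (x : ∀ i, X i) : ∃ c, lam c = x := by
  classical
  have := Fintype.ofFinite I
  have key (s : Finset I) : ∃ c, ∀ i ∈ s, lam c i = x i := by
    induction s using Finset.induction_on with
    | empty => exact ⟨Classical.arbitrary C, by simp⟩
    | insert i s hi ih =>
      obtain ⟨c, hc⟩ := ih
      refine ⟨hlam.proj i (x i) c, fun j hj => ?_⟩
      by_cases hji : j = i
      · subst hji
        exact hlam.proj_colour _ _ c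
      · rw [hlam.proj_colour_of_ne hji]
        exact hc j ((Finset.mem_insert.1 hj).resolve_left hji)
  obtain ⟨c, hc⟩ := key Finset.univ
  exact ⟨c, funext fun i => hc i (Finset.mem_univ i)⟩

end IsLegalColouring

end ChamberSystem

/-! ### Maps out of a building by transport along galleries. -/

/-- The maps `m i x`, thought of as moving a point of `Y` within its `i`-panel to the colour `x`,
interact like the panel projections of a coloured right-angled building of type `M`. -/
structure CoxeterMatrix.PanelMoves {I : Type*} (M : CoxeterMatrix I) {X : I → Type*} {Y : Type*}
    (m : ∀ i, X i → Y → Y) : Prop where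
  move_move (i : I) (x z : X i) (y : Y) : m i x (m i z y) = m i x y
  move_comm {i j : I} (h : M i j = 2) (x : X i) (z : X j) (y : Y) :
    m i x (m j z y) = m j z (m i x y)
  fixed {i j : I} (h : j ≠ i) (x : X j) (z : X i) (y : Y) :
    m j x y = y → m j x (m i z y) = m i z y

namespace ChamberSystem

variable {I C Y : Type*} {S : ChamberSystem I C} {M : CoxeterMatrix I} {X : I → Type*}
  {lam : C → ∀ i, X i} {δ : C → C → M.Group}

theorem IsLegalColouring.panelMoves (hlam : S.IsLegalColouring lam) (hδ : S.IsWeylDist M δ)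
    (hM : M.IsRightAngled) : M.PanelMoves hlam.proj where
  move_move := hlam.proj_proj
  move_comm h := hlam.proj_comm hδ hM h
  fixed h x z y := by
    rw [hlam.proj_eq_self_iff, hlam.proj_eq_self_iff, hlam.proj_colour_of_ne h]
    exact id

/-- A gallery of type `f` from `c` to `c₀` moves the point `y₀` to `y`. -/
inductive Track (S : ChamberSystem I C) (lam : C → ∀ i, X i) (m : ∀ i, X i → Y → Y) (c₀ : C)
    (y₀ : Y) : List I → C → Y → Prop
  | nil : Track S lam m c₀ y₀ [] c₀ y₀
  | cons {i : I} {f : List I} {c d : C} {y : Y} :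
      S.Adj i d c → Track S lam m c₀ y₀ f c y → Track S lam m c₀ y₀ (i :: f) d (m i (lam d i) y)

namespace Track

variable {m : ∀ i, X i → Y → Y} {c₀ : C} {y₀ : Y}

theorem joined {f : List I} {c : C} {y : Y} (h : S.Track lam m c₀ y₀ f c y) :
    S.Joined f c c₀ := by
  induction h with
  | nil => exact Joined.nil _
  | cons h _ ih => exact Joined.cons h ih

theorem exists_of_joined {f : List I} {c : C} (h : S.Joined f c c₀) :
    ∃ y, S.Track lam m c₀ y₀ f c y := by
  induction h with
  | nil c => exact ⟨y₀, nil⟩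
  | cons h _ ih =>
    obtain ⟨y, hy⟩ := ih
    exact ⟨_, cons h hy⟩

theorem move_eq (hlam : S.IsLegalColouring lam) (hm : M.PanelMoves m)
    (h₀ : ∀ i, m i (lam c₀ i) y₀ = y₀) {f : List I} {c : C} {y : Y}
    (h : S.Track lam m c₀ y₀ f c y) (j : I) : m j (lam c j) y = y := by
  induction h with
  | nil => exact h₀ j
  | @cons i f c d y h _ ih =>
    by_cases hji : j = i
    · subst hji
      exact hm.move_move j _ _ y
    · refine hm.fixed hji _ _ y ?_
      rwa [← hlam.colour_eq hji h.1]

/-- For a swap, the gallery is rerouted around the opposite side of a square. Opposite sides carry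
the same colours, so the same two moves occur in the other order. -/
theorem of_comm (hδ : S.IsWeylDist M δ) (hM : M.IsRightAngled) (hlam : S.IsLegalColouring lam)
    (hm : M.PanelMoves m) {f g : List I} (hfg : M.Comm f g) {c : C} {y : Y}
    (h : S.Track lam m c₀ y₀ f c y) : S.Track lam m c₀ y₀ g c y := by
  induction hfg generalizing c y with
  | nil => exact h
  | cons i _ ih =>
    obtain _ | ⟨h₁, h₂⟩ := h
    exact cons h₁ (ih h₂)
  | @swap i j f hij =>
    have hne := CoxeterMatrix.ne_of_eq_two hij
    obtain _ | ⟨h₁, _ | ⟨h₂, h₃⟩⟩ := h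
    obtain ⟨b, hb, hb'⟩ := hδ.exists_adj_adj hM hij h₁ h₂
    have h₄ := cons hb (cons hb' h₃)
    rw [hlam.colour_eq hne hb.1, ← hm.move_comm hij, ← hlam.colour_eq hne.symm h₁.1] at h₄
    exact h₄
  | trans _ _ ih₁ ih₂ => exact ih₂ (ih₁ h)

/-- A gallery of reduced type is determined by its type and endpoints. -/
theorem unique (hδ : S.IsWeylDist M δ) {f : List I} (hf : M.toCoxeterSystem.IsReduced f) {c : C}
    {y y' : Y} (h : S.Track lam m c₀ y₀ f c y) (h' : S.Track lam m c₀ y₀ f c y') : y = y' := by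
  induction h generalizing y' with
  | nil =>
    cases h'
    rfl
  | cons h₁ h₂ ih =>
    obtain _ | ⟨h₃, h₄⟩ := h'
    obtain rfl := hδ.eq_of_joined hf h₁ h₃ h₂.joined h₄.joined
    rw [ih hf.of_cons h₄]

theorem exists_isReduced (hδ : S.IsWeylDist M δ) (hM : M.IsRightAngled)
    (hlam : S.IsLegalColouring lam) (hm : M.PanelMoves m) (h₀ : ∀ i, m i (lam c₀ i) y₀ = y₀)
    {f : List I} {c : C} {y : Y} (h : S.Track lam m c₀ y₀ f c y) :
    ∃ g, M.toCoxeterSystem.IsReduced g ∧ S.Track lam m c₀ y₀ g c y := by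
  induction h with
  | nil => exact ⟨[], by simp [CoxeterSystem.IsReduced], nil⟩
  | @cons i f c d y h _ ih =>
    obtain ⟨g, hg, ht⟩ := ih
    obtain hl | hl := M.toCoxeterSystem.length_simple_mul (M.toCoxeterSystem.wordProd g) i
    · refine ⟨i :: g, ?_, cons h ht⟩
      rw [CoxeterSystem.IsReduced, CoxeterSystem.wordProd_cons, hl, hg.eq, List.length_cons]
    · obtain ⟨g', hg', hw⟩ := M.toCoxeterSystem.exists_isReduced
        (M.toCoxeterSystem.simple i * M.toCoxeterSystem.wordProd g)
      have hi' : M.toCoxeterSystem.wordProd (i :: g') = M.toCoxeterSystem.wordProd g := by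
        rw [CoxeterSystem.wordProd_cons, ← hw, CoxeterSystem.simple_mul_simple_cancel_left]
      have hi : M.toCoxeterSystem.IsReduced (i :: g') := by
        rw [CoxeterSystem.IsReduced, hi', ← hl, hw, hg'.eq, List.length_cons]
      -- Now the track begins with two steps `d → c → b` in one `i`-panel. They cancel if `b = d`
      -- and merge into a single step otherwise.
      have ht' := ht.of_comm hδ hM hlam hm (hM.comm_of_wordProd_eq hg hi hi'.symm)
      obtain _ | @⟨_, _, b, _, z, hb, hj⟩ := ht'
      rw [hm.move_move]
      by_cases hbd : b = d
      · subst hbd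
        rw [hj.move_eq hlam hm h₀]
        exact ⟨g', hg', hj⟩
      · exact ⟨i :: g', hi, cons (h.trans hb (Ne.symm hbd)) hj⟩

theorem eq_of_track (hδ : S.IsWeylDist M δ) (hM : M.IsRightAngled)
    (hlam : S.IsLegalColouring lam) (hm : M.PanelMoves m) (h₀ : ∀ i, m i (lam c₀ i) y₀ = y₀)
    {f g : List I} {c : C} {y z : Y} (h : S.Track lam m c₀ y₀ f c y)
    (h' : S.Track lam m c₀ y₀ g c z) : y = z := by
  obtain ⟨f', hf', h₁⟩ := h.exists_isReduced hδ hM hlam hm h₀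
  obtain ⟨g', hg', h₂⟩ := h'.exists_isReduced hδ hM hlam hm h₀
  have h₃ := (hδ f' hf' c c₀).2 h₁.joined
  rw [(hδ g' hg' c c₀).2 h₂.joined] at h₃
  exact unique hδ hg' (h₁.of_comm hδ hM hlam hm (hM.comm_of_wordProd_eq hf' hg' h₃.symm)) h₂

end Track

/-- A compatible family of panel moves on `Y` and a base point determine a map from the building
to `Y`. -/
theorem IsLegalColouring.exists_map (hlam : S.IsLegalColouring lam) (hδ : S.IsWeylDist M δ)
    (hM : M.IsRightAngled) {m : ∀ i, X i → Y → Y} (hm : M.PanelMoves m) (c₀ : C) (y₀ : Y)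
    (h₀ : ∀ i, m i (lam c₀ i) y₀ = y₀) :
    ∃ φ : C → Y, φ c₀ = y₀ ∧ ∀ i c d, S.rel i c d → φ d = m i (lam d i) (φ c) := by
  have hex (c : C) : ∃ y, ∃ f, S.Track lam m c₀ y₀ f c y := by
    obtain ⟨f, -, -, hf⟩ := hδ.exists_joined c c₀
    obtain ⟨y, hy⟩ := Track.exists_of_joined (lam := lam) (m := m) (y₀ := y₀) hf
    exact ⟨y, f, hy⟩
  choose φ f hφ using hex
  refine ⟨φ, (hφ c₀).eq_of_track hδ hM hlam hm h₀ Track.nil, fun i c d h => ?_⟩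
  by_cases hcd : d = c
  · subst hcd
    exact ((hφ d).move_eq hlam hm h₀ i).symm
  · exact (hφ d).eq_of_track hδ hM hlam hm h₀
      (Track.cons ⟨(S.rel i).symm h, hcd⟩ (hφ c))

end ChamberSystem

/-! ### Collapsing types: moves and Coxeter groups. -/

open Classical in
/-- Extend a family of moves indexed by `{i // p i}` by identity maps. -/
noncomputable def extendMoves {I Y : Type*} {p : I → Prop} {X : I → Type*}
    {Z : {i // p i} → Type*} (k : ∀ i : {i // p i}, X i.1 → Z i)
    (P : ∀ i, Z i → Y → Y) (i : I) (x : X i) (y : Y) : Y :=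
  if h : p i then P ⟨i, h⟩ (k ⟨i, h⟩ x) y else y

section extendMoves

variable {I Y : Type*} {p : I → Prop} {X : I → Type*} {Z : {i // p i} → Type*}
  (k : ∀ i : {i // p i}, X i.1 → Z i) (P : ∀ i, Z i → Y → Y)

theorem extendMoves_coe (i : {i // p i}) (x : X i) (y : Y) :
    extendMoves k P i.1 x y = P i (k i x) y := dif_pos i.2

theorem extendMoves_of_not {i : I} (h : ¬ p i) (x : X i) (y : Y) :
    extendMoves k P i x y = y := dif_neg h

theorem CoxeterMatrix.PanelMoves.extendMoves {M : CoxeterMatrix I} {P : ∀ i, Z i → Y → Y}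
    (hP : (M.induce p).PanelMoves P) : M.PanelMoves (extendMoves k P) where
  move_move i x z y := by
    unfold _root_.extendMoves
    split_ifs
    exacts [hP.move_move _ _ _ _, rfl]
  move_comm {i j} h x z y := by
    unfold _root_.extendMoves
    by_cases hi : p i <;> by_cases hj : p j <;> simp only [hi, hj, dif_pos, dif_neg, not_false_iff]
    exact hP.move_comm (i := ⟨i, hi⟩) (j := ⟨j, hj⟩) h _ _ _
  fixed {i j} h x z y := by
    unfold _root_.extendMoves
    by_cases hi : p i <;> by_cases hj : p j <;>
      simp only [hi, hj, dif_pos, dif_neg, not_false_iff, imp_self]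
    exact hP.fixed (i := ⟨i, hi⟩) (j := ⟨j, hj⟩) (fun e => h (congrArg Subtype.val e)) _ _ _

end extendMoves

namespace CoxeterMatrix

variable {I : Type*} {M : CoxeterMatrix I}

theorem IsRightAngled.induce (hM : M.IsRightAngled) (p : I → Prop) :
    (M.induce p).IsRightAngled :=
  fun i j hij => hM i.1 j.1 fun e => hij (Subtype.ext e)

open Classical in
/-- A right-angled Coxeter group retracts onto its standard parabolic subgroups by killing the
remaining generators. -/
theorem IsRightAngled.exists_retraction (hM : M.IsRightAngled) (p : I → Prop) :
    ∃ ρ : M.Group →* (M.induce p).Group, ∀ i, ρ (M.toCoxeterSystem.simple i) =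
      if h : p i then (M.induce p).toCoxeterSystem.simple ⟨i, h⟩ else 1 := by
  have hφ : M.IsLiftable fun i =>
      if h : p i then (M.induce p).toCoxeterSystem.simple ⟨i, h⟩ else 1 := by
    refine hM.isLiftable (fun i => ?_) fun i j h => ?_
    · by_cases hi : p i <;> simp only [hi, dif_pos, dif_neg, not_false_iff, mul_one]
      exact CoxeterSystem.simple_mul_simple_self _ _
    · by_cases hi : p i <;> by_cases hj : p j <;>
        simp only [hi, hj, dif_pos, dif_neg, not_false_iff, mul_one, one_mul]
      exact simple_comm (M := M.induce p) (i := ⟨i, hi⟩) (j := ⟨j, hj⟩) h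
  exact ⟨M.toCoxeterSystem.lift ⟨_, hφ⟩, fun i => CoxeterSystem.lift_apply_simple _ hφ i⟩

/-- The inclusion of a standard parabolic subgroup. -/
theorem exists_inclusion (M : CoxeterMatrix I) (p : I → Prop) :
    ∃ ι : (M.induce p).Group →* M.Group, ∀ i,
      ι ((M.induce p).toCoxeterSystem.simple i) = M.toCoxeterSystem.simple i.1 := by
  have hφ : (M.induce p).IsLiftable fun i => M.toCoxeterSystem.simple i.1 :=
    fun i j => M.toCoxeterSystem.simple_mul_simple_pow i.1 j.1
  exact ⟨(M.induce p).toCoxeterSystem.lift ⟨_, hφ⟩,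
    fun i => CoxeterSystem.lift_apply_simple _ hφ i⟩

theorem wordProd_map_val {p : I → Prop} {ι : (M.induce p).Group →* M.Group}
    (hι : ∀ i, ι ((M.induce p).toCoxeterSystem.simple i) = M.toCoxeterSystem.simple i.1)
    (f : List {i // p i}) :
    M.toCoxeterSystem.wordProd (f.map Subtype.val) =
      ι ((M.induce p).toCoxeterSystem.wordProd f) := by
  induction f with
  | nil => simp
  | cons i f ih =>
    rw [List.map_cons, CoxeterSystem.wordProd_cons, CoxeterSystem.wordProd_cons, map_mul, ih, hι]

open Classical in
theorem retraction_wordProd_map_val {p : I → Prop} {ρ : M.Group →* (M.induce p).Group}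
    (hρ : ∀ i, ρ (M.toCoxeterSystem.simple i) =
      if h : p i then (M.induce p).toCoxeterSystem.simple ⟨i, h⟩ else 1)
    (f : List {i // p i}) :
    ρ (M.toCoxeterSystem.wordProd (f.map Subtype.val)) =
      (M.induce p).toCoxeterSystem.wordProd f := by
  induction f with
  | nil => simp
  | cons i f ih =>
    rw [List.map_cons, CoxeterSystem.wordProd_cons, CoxeterSystem.wordProd_cons, map_mul, ih, hρ,
      dif_pos i.2]

open Classical in
theorem length_retraction_le {p : I → Prop} {ρ : M.Group →* (M.induce p).Group}
    (hρ : ∀ i, ρ (M.toCoxeterSystem.simple i) =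
      if h : p i then (M.induce p).toCoxeterSystem.simple ⟨i, h⟩ else 1) (w : M.Group) :
    (M.induce p).toCoxeterSystem.length (ρ w) ≤ M.toCoxeterSystem.length w := by
  obtain ⟨f, hf, rfl⟩ := M.toCoxeterSystem.exists_isReduced w
  rw [hf.eq]
  clear hf
  induction f with
  | nil => simp
  | cons i f ih =>
    rw [CoxeterSystem.wordProd_cons, map_mul, hρ, List.length_cons]
    split_ifs with h
    · have := (M.induce p).toCoxeterSystem.length_simple_mul
        (ρ (M.toCoxeterSystem.wordProd f)) ⟨i, h⟩
      omega
    · rw [one_mul]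
      omega

open Classical in
-- The retraction does not increase length and sends the included element back to one of full
-- length.
theorem isReduced_map_val {p : I → Prop} {ρ : M.Group →* (M.induce p).Group}
    (hρ : ∀ i, ρ (M.toCoxeterSystem.simple i) =
      if h : p i then (M.induce p).toCoxeterSystem.simple ⟨i, h⟩ else 1)
    {f : List {i // p i}} (hf : (M.induce p).toCoxeterSystem.IsReduced f) :
    M.toCoxeterSystem.IsReduced (f.map Subtype.val) := by
  refine le_antisymm (M.toCoxeterSystem.length_wordProd_le _) ?_
  have h := length_retraction_le hρ (M.toCoxeterSystem.wordProd (f.map Subtype.val))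
  rwa [retraction_wordProd_map_val hρ, hf.eq, ← List.length_map (f := Subtype.val)] at h

end CoxeterMatrix

/-! ### The imploded building and the map onto it. -/

namespace ChamberSystem

section

variable {I C : Type*} {S : ChamberSystem I C} {M : CoxeterMatrix I}

/-- The chamber system of types `{i // p i}` on a set `D` of chambers. -/
def restrict (S : ChamberSystem I C) (p : I → Prop) (D : Set C) : ChamberSystem {i // p i} D :=
  ⟨fun i => (S.rel i.1).comap Subtype.val⟩

theorem Joined.of_restrict {p : I → Prop} {D : Set C} {f : List {i // p i}} {c d : D}
    (h : (S.restrict p D).Joined f c d) : S.Joined (f.map Subtype.val) c d := by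
  induction h with
  | nil c => exact Joined.nil _
  | cons h _ ih => exact Joined.cons ⟨h.1, fun e => h.2 (Subtype.ext e)⟩ ih

/-- Apply `φ` to the gallery and drop the steps at which it stutters, among them all those of type
outside `p`. -/
theorem Joined.retract {p : I → Prop} {D : Set C} {φ : C → C} (hD : ∀ c, φ c ∈ D)
    (h₁ : ∀ i, p i → ∀ c d, S.rel i c d → S.rel i (φ c) (φ d))
    (h₂ : ∀ i, ¬ p i → ∀ c d, S.rel i c d → φ c = φ d) {f : List I} {c d : C}
    (h : S.Joined f c d) :
    ∃ g : List {i // p i}, (S.restrict p D).Joined g ⟨φ c, hD c⟩ ⟨φ d, hD d⟩ ∧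
      (g.map Subtype.val).Sublist f := by
  induction h with
  | nil c => exact ⟨[], Joined.nil _, List.Sublist.refl _⟩
  | @cons i f c b d h _ ih =>
    obtain ⟨g, hg, hs⟩ := ih
    by_cases hcb : φ c = φ b
    · refine ⟨g, ?_, hs.cons i⟩
      simpa only [hcb] using hg
    · have hi : p i := by
        by_contra hi
        exact hcb (h₂ i hi c b h.1)
      exact ⟨⟨i, hi⟩ :: g, Joined.cons ⟨h₁ i hi c b h.1, fun e => hcb (congrArg Subtype.val e)⟩ hg,
        hs.cons_cons i⟩

/-- The image of a type-collapsing retraction of a right-angled building has a Weyl distance. -/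
theorem IsWeylDist.exists_restrict {δ : C → C → M.Group} (hδ : S.IsWeylDist M δ)
    (hM : M.IsRightAngled) {p : I → Prop} {D : Set C} {φ : C → C} (hD : ∀ c, φ c ∈ D)
    (hφ : ∀ c ∈ D, φ c = c)
    (h₁ : ∀ i, p i → ∀ c d, S.rel i c d → S.rel i (φ c) (φ d))
    (h₂ : ∀ i, ¬ p i → ∀ c d, S.rel i c d → φ c = φ d) :
    ∃ δ', (S.restrict p D).IsWeylDist (M.induce p) δ' := by
  classical
  obtain ⟨ρ, hρ⟩ := hM.exists_retraction p
  obtain ⟨ι, hι⟩ := M.exists_inclusion p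
  -- The retracted gallery has type a sublist of `f`, yet it cannot be shorter than the Weyl
  -- distance. So nothing was dropped and `f` uses only letters in `p`.
  have key (f : List I) (hf : M.toCoxeterSystem.IsReduced f) (c d : D)
      (h : δ c d = M.toCoxeterSystem.wordProd f) :
      ∃ g : List {i // p i}, g.map Subtype.val = f ∧ (S.restrict p D).Joined g c d := by
    obtain ⟨g, hg, hs⟩ := ((hδ f hf c d).1 h).retract hD h₁ h₂
    simp only [hφ _ c.2, hφ _ d.2] at hg
    have hl := hδ.length_le hg.of_restrict
    rw [h, hf.eq] at hl
    exact ⟨g, hs.eq_of_length_le hl, hg⟩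
  refine ⟨fun c d => ρ (δ c d), fun f hf c d => ⟨fun h => ?_, fun h => ?_⟩⟩ <;> beta_reduce at *
  · obtain ⟨h', hr, hw⟩ := M.toCoxeterSystem.exists_isReduced (δ c d)
    obtain ⟨g, rfl, -⟩ := key h' hr c d hw
    -- Both elements lie in the parabolic subgroup, where `ρ` is injective.
    have hfg : δ c d = M.toCoxeterSystem.wordProd (f.map Subtype.val) := by
      rw [hw, CoxeterMatrix.retraction_wordProd_map_val hρ] at h
      rw [hw, CoxeterMatrix.wordProd_map_val hι, h, CoxeterMatrix.wordProd_map_val hι]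
    obtain ⟨g', hg', hj⟩ := key _ (CoxeterMatrix.isReduced_map_val hρ hf) c d hfg
    rwa [(Subtype.val_injective.list_map) hg'] at hj
  · rw [(hδ _ (CoxeterMatrix.isReduced_map_val hρ hf) c d).2 h.of_restrict,
      CoxeterMatrix.retraction_wordProd_map_val hρ]

theorem IsLegalColouring.exists_adj {X : I → Type*} {lam : C → ∀ i, X i}
    (hlam : S.IsLegalColouring lam) (i : I) [Nontrivial (X i)] (c : C) : ∃ d, S.Adj i c d := by
  obtain ⟨x, hx⟩ := exists_ne (lam c i)
  exact ⟨hlam.proj i x c, hlam.rel_proj i x c,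
    fun h => hx (hlam.proj_eq_self_iff.1 h.symm).symm⟩

end

theorem IsLegalColouring.isSemiregular {I : Type u} {C : Type v} {S : ChamberSystem I C}
    {X : I → Type w} {lam : C → ∀ i, X i} (hlam : S.IsLegalColouring lam)
    [∀ i, Nontrivial (X i)] : S.IsSemiregular fun i => Cardinal.mk (X i) := by
  refine fun i => ⟨Cardinal.two_le_iff.2 (exists_pair_ne (X i)), fun c => ?_⟩
  exact Cardinal.lift_mk_eq'.2 ⟨((hlam.bijOn i c).equiv _).trans (Equiv.Set.univ _)⟩

theorem IsLegalColouring.exists_implosion {I : Type u} [Finite I] {C : Type v}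
    {M : CoxeterMatrix I} {S : ChamberSystem I C} {X : I → Type w} (hB : S.IsBuilding M)
    (hM : M.IsRightAngled) {lam : C → ∀ i, X i} (hlam : S.IsLegalColouring lam)
    (r : ∀ i, Setoid (X i)) :
    ∃ (C' : Type v) (S' : ChamberSystem {i // r i ≠ ⊤} C')
      (lam' : C' → ∀ i : {i // r i ≠ ⊤}, Quotient (r i.1)),
      S'.IsSemiregularRAB (M.induce fun i => r i ≠ ⊤)
        (fun i => Cardinal.mk (Quotient (r i.1))) ∧
      S'.IsLegalColouring lam' := by
  have := hB.nonempty
  obtain ⟨δ, hδ : S.IsWeylDist M δ⟩ := hB.exists_weylDist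
  let p : I → Prop := fun i => r i ≠ ⊤
  let P : ∀ i : {i // p i}, Quotient (r i.1) → C → C := fun i q => hlam.proj i.1 q.out
  let k : ∀ i : {i // p i}, X i.1 → Quotient (r i.1) := fun i => Quotient.mk (r i.1)
  have hm := hlam.panelMoves hδ hM
  have hP : (M.induce p).PanelMoves P :=
    { move_move := fun i x z y => hm.move_move i.1 _ _ y
      move_comm := fun {i j} h x z y => hm.move_comm (i := i.1) (j := j.1) h _ _ y
      fixed := fun {i j} h x z y => hm.fixed (fun e => h (Subtype.ext e)) _ _ y }
  -- All colours of the base chamber are chosen representatives, so every move towards one of its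
  -- own colours fixes it.
  obtain ⟨c₀, hc₀⟩ := hlam.exists_colour_eq fun i =>
    (Quotient.mk (r i) (lam (Classical.arbitrary C) i)).out
  have h₀ (i : I) : extendMoves k P i (lam c₀ i) c₀ = c₀ := by
    by_cases hi : p i
    · rw [extendMoves_coe k P ⟨i, hi⟩]
      refine hlam.proj_eq_self_iff.2 ?_
      rw [hc₀]
      simp only [k, Quotient.out_eq]
    · exact extendMoves_of_not k P hi _ _
  obtain ⟨φ, hφ₀, hφ⟩ := hlam.exists_map hδ hM (hP.extendMoves k) c₀ c₀ h₀
  have hφ₁ (i : {i // p i}) {c d : C} (h : S.rel i.1 c d) :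
      φ d = hlam.proj i.1 (k i (lam d i.1)).out (φ c) := by
    rw [hφ i.1 c d h, extendMoves_coe k P]
  have hφ₂ (i : I) (hi : ¬ p i) (c d : C) (h : S.rel i c d) : φ c = φ d := by
    rw [hφ i c d h, extendMoves_of_not k P hi]
  let D : Set C := {c | φ c = c}
  have hcol (i : {i // p i}) {c : C} (hc : c ∈ D) : (k i (lam c i.1)).out = lam c i.1 := by
    have h := hφ₁ i ((S.rel i.1).refl c)
    rw [show φ c = c from hc] at h
    exact (hlam.proj_eq_self_iff.1 h.symm).symm
  have hproj (i : {i // p i}) (q : Quotient (r i.1)) {c : C} (hc : c ∈ D) :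
      hlam.proj i.1 q.out c ∈ D := by
    have h := hφ₁ i (hlam.rel_proj i.1 q.out c)
    rw [hlam.proj_colour, show φ c = c from hc] at h
    change φ (hlam.proj i.1 q.out c) = hlam.proj i.1 q.out c
    simpa only [k, Quotient.out_eq] using h
  have hD (c : C) : φ c ∈ D := by
    have hc₀D : φ c₀ ∈ D := (congrArg φ hφ₀ : φ (φ c₀) = φ c₀)
    refine hδ.induction_on (P := fun c => φ c ∈ D) hc₀D (fun i c d h ih => ?_) c
    by_cases hi : p i
    · rw [hφ₁ ⟨i, hi⟩ h.1]
      exact hproj ⟨i, hi⟩ _ ih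
    · rwa [← hφ₂ i hi c d h.1]
  -- Non-universality of the relation gives at least two colour classes, hence panels with at least
  -- two chambers.
  have hnt (i : {i // p i}) : Nontrivial (Quotient (r i.1)) := by
    by_contra hn
    rw [not_nontrivial_iff_subsingleton] at hn
    refine i.2 (Setoid.ext fun a b => ?_)
    exact ⟨fun _ => trivial, fun _ => Quotient.exact (Subsingleton.elim _ _)⟩
  obtain ⟨δ', hδ'⟩ := hδ.exists_restrict hM hD (fun c hc => hc)
    (fun i hi c d h => by
      rw [hφ₁ ⟨i, hi⟩ h]
      exact hlam.rel_proj _ _ _) hφ₂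
  have hlam' : (S.restrict p D).IsLegalColouring fun c i => k i (lam c.1 i.1) := by
    refine ⟨fun i c => ⟨fun _ _ => Set.mem_univ _, ?_, ?_⟩, ?_⟩
    · intro a ha b hb (hab : k i (lam a.1 i.1) = k i (lam b.1 i.1))
      refine Subtype.ext (hlam.eq_of_rel (i := i.1) ?_ ?_)
      · exact (S.rel i.1).trans ((S.rel i.1).symm ha) hb
      · rw [← hcol i a.2, hab, hcol i b.2]
    · intro q _
      refine ⟨⟨hlam.proj i.1 q.out c, hproj i q c.2⟩, hlam.rel_proj i.1 _ c.1, ?_⟩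
      simp only [k, hlam.proj_colour, Quotient.out_eq]
    · intro i c j hji d hd
      exact congrArg (k j) (hlam.colour_eq (fun e => hji (Subtype.ext e)) hd)
  exact ⟨D, S.restrict p D, _,
    ⟨hM.induce p, ⟨⟨⟨c₀, hφ₀⟩⟩, fun i c => hlam'.exists_adj i c, δ', hδ'⟩, hlam'.isSemiregular⟩,
    hlam'⟩

theorem graph_dist_map_le {I I' C C' : Type*} {S : ChamberSystem I C} {S' : ChamberSystem I' C'}
    (hS : S.graph.Connected) (hS' : S'.graph.Connected) {τ : C → C'}
    (hτ : ∀ c d, S.graph.Adj c d → τ c = τ d ∨ S'.graph.Adj (τ c) (τ d)) (c d : C) :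
    S'.dist (τ c) (τ d) ≤ S.dist c d := by
  obtain ⟨γ, hγ⟩ := hS.exists_walk_length_eq_dist c d
  unfold dist
  rw [← hγ]
  clear hγ
  induction γ with
  | nil => simp
  | @cons a b e h γ ih =>
    rw [SimpleGraph.Walk.length_cons]
    obtain h' | h' := hτ a b h
    · rw [h']
      omega
    · have h₁ := hS'.dist_triangle (u := τ a) (v := τ b) (w := τ e)
      rw [SimpleGraph.dist_eq_one_iff_adj.2 h'] at h₁
      omega

theorem IsLegalColouring.exists_implosion_map {I : Type u} [Finite I] {C : Type v}
    {M : CoxeterMatrix I} {S : ChamberSystem I C} {X : I → Type w} (hB : S.IsBuilding M)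
    (hM : M.IsRightAngled) {lam : C → ∀ i, X i} (hlam : S.IsLegalColouring lam)
    (r : ∀ i, Setoid (X i)) {C' : Type v'} {S' : ChamberSystem {i // r i ≠ ⊤} C'}
    {lam' : C' → ∀ i : {i // r i ≠ ⊤}, Quotient (r i.1)}
    (hB' : S'.IsBuilding (M.induce fun i => r i ≠ ⊤)) (hlam' : S'.IsLegalColouring lam') :
    ∃ τ : C → C', Function.Surjective τ ∧
      (∀ (c : C) (i : {i // r i ≠ ⊤}), lam' (τ c) i = Quotient.mk (r i.1) (lam c i.1)) ∧
      ∀ c₁ c₂ : C, S'.dist (τ c₁) (τ c₂) ≤ S.dist c₁ c₂ := by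
  have := hB.nonempty
  have := hB'.nonempty
  obtain ⟨δ, hδ : S.IsWeylDist M δ⟩ := hB.exists_weylDist
  obtain ⟨δ', hδ' : S'.IsWeylDist _ δ'⟩ := hB'.exists_weylDist
  let p : I → Prop := fun i => r i ≠ ⊤
  let k : ∀ i : {i // p i}, X i.1 → Quotient (r i.1) := fun i => Quotient.mk (r i.1)
  let c₀ : C := Classical.arbitrary C
  obtain ⟨y₀, hy₀⟩ := hlam'.exists_colour_eq fun i => k i (lam c₀ i.1)
  have hP := hlam'.panelMoves hδ' (hM.induce p)
  have h₀ (i : I) : extendMoves k hlam'.proj i (lam c₀ i) y₀ = y₀ := by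
    by_cases hi : p i
    · rw [extendMoves_coe k _ ⟨i, hi⟩, hlam'.proj_eq_self_iff, hy₀]
    · exact extendMoves_of_not k _ hi _ _
  obtain ⟨τ, hτ₀, hτ⟩ := hlam.exists_map hδ hM (hP.extendMoves k) c₀ y₀ h₀
  have hτ₁ (i : {i // p i}) {c d : C} (h : S.rel i.1 c d) :
      τ d = hlam'.proj i (k i (lam d i.1)) (τ c) := by
    rw [hτ i.1 c d h, extendMoves_coe k]
  have hτ₂ (i : I) (hi : ¬ p i) {c d : C} (h : S.rel i c d) : τ c = τ d := by
    rw [hτ i c d h, extendMoves_of_not k _ hi]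
  refine ⟨τ, fun z => ?_, fun c i => ?_, fun c d => ?_⟩
  · refine hδ'.induction_on (P := fun z => ∃ c, τ c = z) ⟨c₀, hτ₀⟩ ?_ z
    rintro i _ z h ⟨c, rfl⟩
    -- Lift the step to `z`: the chamber of colour `x` in the `i`-panel of `c` maps to the chamber
    -- in the panel of `τ c` that has the colour of `z`, namely `z`.
    obtain ⟨x, hx⟩ := Quotient.exists_rep (lam' z i)
    refine ⟨hlam.proj i.1 x c, ?_⟩
    rw [hτ₁ i (hlam.rel_proj i.1 x c), hlam.proj_colour, show k i x = lam' z i from hx]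
    exact hlam'.proj_eq_of_rel h.1
  · exact hlam'.proj_eq_self_iff.1 (hτ₁ i ((S.rel i.1).refl c)).symm
  · refine graph_dist_map_le hδ.connected hδ'.connected (fun a b ⟨i, hab⟩ => ?_) c d
    by_cases hi : p i
    · refine or_iff_not_imp_left.2 fun hne => ⟨⟨i, hi⟩, ?_, hne⟩
      rw [hτ₁ ⟨i, hi⟩ hab.1]
      exact hlam'.rel_proj _ _ _
    · exact Or.inl (hτ₂ i hi hab.1)

end ChamberSystem

theorem mainTheorem9 {I : Type u} [Finite I] {C : Type v}
    (M : CoxeterMatrix I) (S : ChamberSystem I C) (X : I → Type w)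
    (hS : S.IsSemiregularRAB M fun i => Cardinal.mk (X i))
    (lam : C → ∀ i, X i) (hlam : S.IsLegalColouring lam)
    (r : ∀ i, Setoid (X i)) :
    (∃ (C' : Type v) (S' : ChamberSystem {i // r i ≠ ⊤} C')
        (lam' : C' → ∀ i : {i // r i ≠ ⊤}, Quotient (r i.1)),
      S'.IsSemiregularRAB (M.induce fun i => r i ≠ ⊤)
        (fun i => Cardinal.mk (Quotient (r i.1))) ∧
      S'.IsLegalColouring lam') ∧
    ∀ (C' : Type v') (S' : ChamberSystem {i // r i ≠ ⊤} C')
      (lam' : C' → ∀ i : {i // r i ≠ ⊤}, Quotient (r i.1)),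
      S'.IsSemiregularRAB (M.induce fun i => r i ≠ ⊤)
        (fun i => Cardinal.mk (Quotient (r i.1))) →
      S'.IsLegalColouring lam' →
      ∃ τ : C → C', Function.Surjective τ ∧
        (∀ (c : C) (i : {i // r i ≠ ⊤}), lam' (τ c) i = Quotient.mk (r i.1) (lam c i.1)) ∧
        ∀ c₁ c₂ : C, S'.dist (τ c₁) (τ c₂) ≤ S.dist c₁ c₂ := by
  exact ⟨hlam.exists_implosion hS.building hS.rightAngled r, fun _ _ _ hS' hlam' =>
    hlam.exists_implosion_map hS.building hS.rightAngled r hS'.building hlam'⟩
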